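/- Let $A=\{-1,+1\}$ and let $\mathcal X=A^{\mathbb Z_-}$, $\mathbb Z_-=\{0,-1,-2,\dots\}$, carry the product topology, its Borel $\sigma$-algebra $\mathcal B$ and the coordinatewise order; let $(Tx)_i=x_{i-1}$, and for $a\in A$, $x\in\mathcal X$ let $ax\in\mathcal X$ be the sequence with $(ax)_0=a$ and $(ax)_{i}=x_{i+1}$ for $i\le -1$. A $g$-function is a measurable $g:\mathcal X\to[0,1]$ with $\sum_{a\in A}g(ax)=1$ for all $x$; $\mathcal G$ is the set of continuous, strictly positive $g$-functions. A function $g\in\mathcal G$ is attractive if for every $a\in A$ the map $x\mapsto\sum_{b\ge a}g(bx)$ is increasing. A $g$-measure is a $T$-invariant Borel probability measure $\mu$ on $\mathcal X$ such that $\mu(x_0=a\mid T^{-1}\mathcal B)(x)=g(a\,Tx)$ for $\mu$-almost every $x$, for every $a\in A$. For $k\ge 0$ let $\mathcal M_k$ be the set of ergodic Markov kernels of order $k$, i.e. the $g$-functions for which $g(ax)$ depends only on $a,x_0,\dots,x_{-k+1}$ and whose associated Markov chain on $A^k$ is irreducible and aperiodic, and let $\mathcal M=\bigcup_{k\ge0}\mathcal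 M_k$; every element of $\mathcal M$ has exactly one associated $g$-measure. For $T$-invariant probability measures $\mu,\mu'$ let $$\bar d(\mu,\mu')=\inf_\nu \nu(\{(x,x')\in\mathcal X\times\mathcal X: x_0\neq x_0'\}),$$ where $\nu$ ranges over the $(T\times T)$-invariant couplings of $\mu$ and $\mu'$. Theorem. Let $g\in\mathcal G$ be attractive. There exist at least two distinct $g$-measures if and only if there exist two sequences $(g_j)_{j\ge0}$ and $(g'_j)_{j\ge0}$ in $\mathcal M$, both converging uniformly on $\mathcal X$ to $g$, such that the associated $g_j$-measures $\mu_j$ and $g'_j$-measures $\mu'_j$ satisfy, for some integer $k\ge0$, $$\sum_{j\ge k}\bar d(\mu_j,\mu_{j+1})+\sum_{j\ge k}\bar d(\mu'_j,\mu'_{j+1})<\bar d(\mu_k,\mu'_k).$$ -/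

import Mathlib

open MeasureTheory Filter Topology
open scoped ENNReal

noncomputable section

namespace GMeas

/-- The space `A^{ℤ₋}` of one-sided sequences `x = (…, x₋₂, x₋₁, x₀)`. The coordinate `x₋ₙ` is
`x n` for `n : ℕ`. It carries the product topology, product σ-algebra and coordinatewise order. -/
abbrev PastSpace (A : Type) : Type := ℕ → A

/-- The shift `(T x)ᵢ = xᵢ₋₁`, `i ≤ 0`, which forgets the coordinate `x₀`. -/
def shift {A : Type} (x : PastSpace A) : PastSpace A := fun n => x (n + 1)

/-- The concatenation `a x`: the coordinate at `0` is `a`, and the past is `x`. -/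
def cons {A : Type} (a : A) (x : PastSpace A) : PastSpace A
  | 0 => a
  | n + 1 => x n

/-- `g`-functions: measurable, with values in `[0,1]`, and `∑ₐ g(a x) = 1` for every `x`. -/
structure IsGFunction {A : Type} [Fintype A] [MeasurableSpace A] (g : PastSpace A → ℝ) :
    Prop where
  measurable : Measurable g
  mem_Icc : ∀ x, g x ∈ Set.Icc (0 : ℝ) 1
  sum_eq_one : ∀ x, ∑ a, g (cons a x) = 1

/-- The class `𝒢` of continuous and strictly positive `g`-functions. -/
def posGFunctions (A : Type) [Fintype A] [MeasurableSpace A] [TopologicalSpace A] :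
    Set C(PastSpace A, ℝ) :=
  {g | IsGFunction g ∧ ∀ x, 0 < g x}

/-- Attractiveness: for every `a`, the function `x ↦ ∑_{b ≥ a} g(b x)` is increasing. -/
def Attractive {A : Type} [Fintype A] [LinearOrder A] (g : PastSpace A → ℝ) : Prop :=
  ∀ a : A, Monotone fun x : PastSpace A => ∑ b with a ≤ b, g (cons b x)

/-- `μ` is compatible with `g` (is a `g`-measure): it is a shift-invariant probability measure
and `μ(x₀ = a | T⁻¹ℬ)(x) = g(a x₋₁ x₋₂ …)` almost surely, for every letter `a`. -/
structure IsGMeasure {A : Type} [MeasurableSpace A] (g : PastSpace A → ℝ)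
    (μ : Measure (PastSpace A)) : Prop where
  isProbabilityMeasure : IsProbabilityMeasure μ
  invariant : MeasurePreserving shift μ μ
  condExp_eq : ∀ a : A,
    μ[Set.indicator {x : PastSpace A | x 0 = a} (fun _ => (1 : ℝ)) |
        MeasurableSpace.comap (shift : PastSpace A → PastSpace A) inferInstance]
      =ᵐ[μ] fun x => g (cons a (shift x))

/-- The state of a `k`-th order chain after emitting `a` from the state `w = (x₀, …, x₋ₖ₊₁)`:
the word `(a, x₀, …, x₋ₖ₊₂)`. -/
def pushWord {A : Type} {k : ℕ} (a : A) (w : Fin k → A) : Fin k → A :=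
  fun i => (Fin.cons a w : Fin (k + 1) → A) i.castSucc

/-- The transition matrix on the words of length `k` of the chain which, in state `w`, emits the
letter `a` with probability `p w a`. -/
def transitionMatrix {A : Type} [Fintype A] [DecidableEq A] {k : ℕ}
    (p : (Fin k → A) → A → ℝ) : Matrix (Fin k → A) (Fin k → A) ℝ :=
  fun w w' => ∑ a, if w' = pushWord a w then p w a else 0

/-- The class `ℳₖ` of `k`-th order ergodic Markov kernels: continuous `g`-functions for which
`g(a x)` depends only on `a` and the `k` last letters of the past `x`, and whose chain on the
words of length `k` is ergodic, that is, irreducible and aperiodic (the transition matrix is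
primitive). -/
def markovKernels (A : Type) [Fintype A] [DecidableEq A] [MeasurableSpace A]
    [TopologicalSpace A] (k : ℕ) : Set C(PastSpace A, ℝ) :=
  {g | IsGFunction g ∧ ∃ p : (Fin k → A) → A → ℝ,
    (∀ (a : A) (x : PastSpace A), g (cons a x) = p (fun i => x i) a) ∧
    (transitionMatrix p).IsPrimitive}

/-- The class `ℳ` of ergodic Markov kernels of any finite order. -/
def allMarkovKernels (A : Type) [Fintype A] [DecidableEq A] [MeasurableSpace A]
    [TopologicalSpace A] : Set C(PastSpace A, ℝ) :=
  ⋃ k : ℕ, markovKernels A k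

/-- The stationary couplings of `μ` and `μ'`. -/
def stationaryCouplings {A : Type} [MeasurableSpace A] (μ μ' : Measure (PastSpace A)) :
    Set (Measure (PastSpace A × PastSpace A)) :=
  {ν | ν.fst = μ ∧ ν.snd = μ' ∧ MeasurePreserving (Prod.map shift shift) ν ν}

/-- The `d̄`-distance: the infimum over the stationary couplings of the probability that the
coordinates at `0` differ. -/
def dbar {A : Type} [MeasurableSpace A] (μ μ' : Measure (PastSpace A)) : ℝ≥0∞ :=
  ⨅ ν ∈ stationaryCouplings μ μ', ν {z | z.1 0 ≠ z.2 0}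

/-- The alphabet `{-1, +1}`. -/
abbrev Spin : Type := ({-1, 1} : Finset ℤ)

end GMeas

end

noncomputable section

namespace GMeas

/-! Two distinct `g`-measures give the sequences by a monotone coupling. Take the Markov
approximations of `g` that see a constant past, all `+1` or all `-1`, beyond their memory. Drive all
of them and two copies of `g`, started from the two given measures, with one common uniform
threshold (`exists_monotone_coupling`). Attractiveness preserves the order: the plus chains decrease
with the memory, the minus chains increase, and both copies of `g` stay in between. For ordered
components `d̄` is the difference of the densities of `+1` (`dbar_map_le_of_le`,
`ofReal_sub_le_dbar_map`), so both sums telescope. They fall short of the initial distance by at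
least the probability that the two copies of `g` differ at time `0`, which is positive because the
measures differ.

Conversely, a weak limit point of each sequence is a `g`-measure (`isGMeasure_of_tendsto`). By the
triangle inequality and lower semicontinuity of `d̄`, its distance to the `k`-th term is at most the
tail sum (`exists_isGMeasure_dbar_le`). If the two limits coincided, the two sums would bridge the
distance between the `k`-th terms. -/

lemma integrable_of_continuous {Ω E : Type*} [TopologicalSpace Ω] [CompactSpace Ω]
    [MeasurableSpace Ω] [BorelSpace Ω] [NormedAddCommGroup E] [SecondCountableTopology E]
    (μ : Measure Ω) [IsFiniteMeasure μ] {φ : Ω → E}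
    (hφ : Continuous φ) : Integrable φ μ := by
  borelize E
  obtain ⟨C, hC⟩ := isCompact_univ.exists_bound_of_continuousOn hφ.continuousOn
  exact Integrable.of_bound hφ.measurable.aestronglyMeasurable C
    (ae_of_all _ fun x => hC x (Set.mem_univ x))

/-! ### Weak limits and time averages on compact spaces -/

section Limits

variable {Ω : Type*} [TopologicalSpace Ω] [CompactSpace Ω] [T2Space Ω] [MeasurableSpace Ω]
  [BorelSpace Ω]

/-- Weak limits of probability measures on a compact space exist along ultrafilters. -/
lemma exists_tendsto_integral {ι : Type*} (U : Ultrafilter ι) (ρ : ι → Measure Ω)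
    [h : ∀ n, IsProbabilityMeasure (ρ n)] :
    ∃ ν : Measure Ω, IsProbabilityMeasure ν ∧ ∀ φ : Ω → ℝ, Continuous φ →
      Tendsto (fun n => ∫ x, φ x ∂ρ n) U (𝓝 (∫ x, φ x ∂ν)) := by
  let p : ι → ProbabilityMeasure Ω := fun n => ⟨ρ n, h n⟩
  obtain ⟨ν, -, hν⟩ := isCompact_univ.ultrafilter_le_nhds (U.map p) (by simp)
  refine ⟨ν, inferInstance, fun φ hφ => ?_⟩
  have hlim : Tendsto p U (𝓝 ν) := hν
  exact ProbabilityMeasure.tendsto_iff_forall_integral_tendsto.1 hlim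
    (BoundedContinuousFunction.mkOfCompact ⟨φ, hφ⟩)

/-- Limit of the averages of a sequence of probability measures on a compact space
(the Krylov–Bogoliubov argument). -/
lemma exists_average_limit (ρ : ℕ → Measure Ω) [∀ n, IsProbabilityMeasure (ρ n)] :
    ∃ ν : Measure Ω, IsProbabilityMeasure ν ∧
      (∀ φ ψ : Ω → ℝ, Continuous φ → Continuous ψ →
        (∀ m, ∫ x, φ x ∂ρ (m + 1) = ∫ x, ψ x ∂ρ m) → ∫ x, φ x ∂ν = ∫ x, ψ x ∂ν) ∧
      (∀ (φ : Ω → ℝ) (c : ℝ), Continuous φ → (∀ m, ∫ x, φ x ∂ρ m ≤ c) → ∫ x, φ x ∂ν ≤ c) := by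
  let a : ℕ → Measure Ω := fun n => ((n : ℝ≥0∞) + 1)⁻¹ • ∑ m ∈ Finset.range (n + 1), ρ m
  have ha : ∀ n, IsProbabilityMeasure (a n) := fun n => ⟨by
    simp only [a, Measure.smul_apply, Measure.finsetSum_apply, measure_univ, Finset.sum_const,
      Finset.card_range, nsmul_eq_mul, mul_one, smul_eq_mul]
    push_cast
    exact ENNReal.inv_mul_cancel (by simp) (by finiteness)⟩
  have hint : ∀ (φ : Ω → ℝ), Continuous φ → ∀ n,
      ∫ x, φ x ∂a n = ((n : ℝ) + 1)⁻¹ * ∑ m ∈ Finset.range (n + 1), ∫ x, φ x ∂ρ m := by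
    intro φ hφ n
    simp only [a]
    rw [integral_smul_measure, integral_finsetSum_measure
      fun i _ => integrable_of_continuous (ρ i) hφ, smul_eq_mul, ENNReal.toReal_inv,
      ENNReal.toReal_add (by simp) (by simp)]
    simp
  obtain ⟨ν, hν, hlim⟩ := exists_tendsto_integral (hyperfilter ℕ) a
  have hU : ((hyperfilter ℕ : Ultrafilter ℕ) : Filter ℕ) ≤ atTop := Nat.hyperfilter_le_atTop
  refine ⟨ν, hν, fun φ ψ hφ hψ h => ?_, fun φ c hφ h => ?_⟩
  · obtain ⟨C, hC⟩ : ∃ C, ∀ m, |∫ x, φ x ∂ρ m| ≤ C := by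
      obtain ⟨C, hC⟩ := isCompact_univ.exists_bound_of_continuousOn hφ.continuousOn
      refine ⟨C, fun m => ?_⟩
      simpa using norm_integral_le_of_norm_le_const (μ := ρ m)
        (ae_of_all _ fun x => hC x (Set.mem_univ x))
    -- The `ψ`-integrals are the `φ`-integrals one step later, so the difference of the sums
    -- telescopes to two boundary terms.
    have hdiff : ∀ n, |∫ x, ψ x ∂a n - ∫ x, φ x ∂a n| ≤ 2 * C * ((n : ℝ) + 1)⁻¹ := by
      intro n
      rw [hint φ hφ, hint ψ hψ, ← mul_sub, ← Finset.sum_sub_distrib]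
      simp_rw [← h]
      rw [Finset.sum_range_sub (fun m => ∫ x, φ x ∂ρ m), abs_mul,
        abs_of_pos (by positivity : (0 : ℝ) < ((n : ℝ) + 1)⁻¹), mul_comm]
      gcongr
      calc _ ≤ |∫ x, φ x ∂ρ (n + 1)| + |∫ x, φ x ∂ρ 0| := abs_sub _ _
        _ ≤ 2 * C := by linarith [hC (n + 1), hC 0]
    have hzero : Tendsto (fun n => ∫ x, ψ x ∂a n - ∫ x, φ x ∂a n) (hyperfilter ℕ) (𝓝 0) := by
      refine squeeze_zero_norm (a := fun n : ℕ => 2 * C * ((n : ℝ) + 1)⁻¹) hdiff ?_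
      have := (tendsto_one_div_add_atTop_nhds_zero_nat (𝕜 := ℝ)).const_mul (2 * C)
      simp only [one_div, mul_zero] at this
      exact this.mono_left hU
    have := tendsto_nhds_unique ((hlim ψ hψ).sub (hlim φ hφ)) hzero
    linarith
  · refine le_of_tendsto (hlim φ hφ) (Eventually.of_forall fun n => ?_)
    rw [hint φ hφ, inv_mul_le_iff₀ (by positivity)]
    calc _ ≤ ∑ m ∈ Finset.range (n + 1), c := Finset.sum_le_sum fun m _ => h m
      _ = _ := by simp

end Limits

/-- Finite measures with the same integrals of continuous functions on a compact space agree. -/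
lemma measure_eq_of_integral_eq {Ω : Type*} [TopologicalSpace Ω] [HasOuterApproxClosed Ω]
    [MeasurableSpace Ω] [BorelSpace Ω] {μ ν : Measure Ω} [IsFiniteMeasure μ] [IsFiniteMeasure ν]
    (h : ∀ φ : Ω → ℝ, Continuous φ → ∫ x, φ x ∂μ = ∫ x, φ x ∂ν) : μ = ν :=
  ext_of_forall_integral_eq_of_IsFiniteMeasure fun f => h f f.continuous

lemma continuous_indicator_of_isClopen {Ω : Type*} [TopologicalSpace Ω] {s : Set Ω}
    (hs : IsClopen s) : Continuous (s.indicator fun _ => (1 : ℝ)) :=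
  continuous_const.indicator (by simp [hs.frontier_eq])

lemma integral_indicator_of_isClopen {Ω : Type*} [TopologicalSpace Ω] [MeasurableSpace Ω]
    [BorelSpace Ω] {s : Set Ω} (hs : IsClopen s) (μ : Measure Ω) :
    ∫ x, s.indicator (fun _ => (1 : ℝ)) x ∂μ = μ.real s := by
  rw [integral_indicator hs.isOpen.measurableSet]; simp

/-! ### `g`-measures as fixed points of the dual transfer operator -/

section TransferOperator

section Basic

variable {A : Type}

@[simp] lemma cons_zero (a : A) (x : PastSpace A) : cons a x 0 = a := rfl

@[simp] lemma cons_succ (a : A) (x : PastSpace A) (n : ℕ) : cons a x (n + 1) = x n := rfl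

@[simp] lemma shift_cons (a : A) (x : PastSpace A) : shift (cons a x) = x := rfl

@[simp] lemma shift_apply (x : PastSpace A) (n : ℕ) : shift x n = x (n + 1) := rfl

lemma cons_zero_shift (x : PastSpace A) : cons (x 0) (shift x) = x := by
  funext n; cases n <;> rfl

lemma shift_iterate_apply (m : ℕ) (x : PastSpace A) (n : ℕ) : shift^[m] x n = x (n + m) := by
  induction m generalizing x with
  | zero => rfl
  | succ m ih => rw [Function.iterate_succ_apply, ih, shift_apply, add_assoc]

variable [TopologicalSpace A]

@[fun_prop] lemma continuous_shift : Continuous (shift : PastSpace A → PastSpace A) :=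
  continuous_pi fun n => continuous_apply (n + 1)

@[fun_prop] lemma continuous_cons (a : A) : Continuous (cons a) :=
  continuous_pi fun n => by cases n <;> simp only [cons_zero, cons_succ] <;> fun_prop

end Basic

lemma measurable_shift {A : Type} [MeasurableSpace A] :
    Measurable (shift : PastSpace A → PastSpace A) :=
  measurable_pi_lambda _ fun n => measurable_pi_apply (n + 1)

lemma isClopen_coord_eq {A : Type} [TopologicalSpace A] [DiscreteTopology A] (a : A) :
    IsClopen {x : PastSpace A | x 0 = a} :=
  (isClopen_discrete ({a} : Set A)).preimage (continuous_apply 0)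

variable {A : Type} [Fintype A] [TopologicalSpace A] [DiscreteTopology A] [MeasurableSpace A]
  [BorelSpace A]

/-- A `g`-measure is invariant under the transfer operator of `g`. -/
lemma IsGMeasure.integral_transfer {g : C(PastSpace A, ℝ)} {μ : Measure (PastSpace A)}
    (h : IsGMeasure g μ) {φ : PastSpace A → ℝ} (hφ : Continuous φ) :
    ∫ x, ∑ a, g (cons a x) * φ (cons a x) ∂μ = ∫ x, φ x ∂μ := by
  classical
  have := h.isProbabilityMeasure
  have hm : MeasurableSpace.comap (shift : PastSpace A → PastSpace A) inferInstance ≤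
      (inferInstance : MeasurableSpace (PastSpace A)) := measurable_shift.comap_le
  -- Each factor `φ (cons a (shift x))` is measurable with respect to the shifted σ-algebra, so it
  -- can be pulled out of the conditional expectation.
  have hsplit : ∀ x, φ x = ∑ a, φ (cons a (shift x)) *
      Set.indicator {x : PastSpace A | x 0 = a} (fun _ => (1 : ℝ)) x := by
    intro x
    rw [Finset.sum_eq_single (x 0)]
    · simp [cons_zero_shift]
    · intro b _ hb
      simp [hb.symm]
    · simp
  have hind := fun a : A => continuous_indicator_of_isClopen (isClopen_coord_eq a)
  have hint : ∀ a : A, Integrable (fun x => φ (cons a (shift x)) *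
      Set.indicator {x : PastSpace A | x 0 = a} (fun _ => (1 : ℝ)) x) μ := fun a =>
    integrable_of_continuous μ
      (((hφ.comp (continuous_cons a)).comp continuous_shift).mul (hind a))
  rw [integral_congr_ae (ae_of_all _ hsplit), integral_finsetSum _ fun a _ =>
      integrable_of_continuous μ (by fun_prop), integral_finsetSum _ fun a _ =>
      hint a]
  refine Finset.sum_congr rfl fun a _ => ?_
  have hmeas : StronglyMeasurable[MeasurableSpace.comap
      (shift : PastSpace A → PastSpace A) inferInstance] fun x => φ (cons a (shift x)) :=
    ((hφ.comp (continuous_cons a)).measurable.comp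
      (comap_measurable (shift : PastSpace A → PastSpace A))).stronglyMeasurable
  have hpull := condExp_mul_of_stronglyMeasurable_left (μ := μ) hmeas
    (hint a) (integrable_of_continuous μ (hind a))
  have hcond : ∫ x, φ (cons a (shift x)) *
      Set.indicator {x : PastSpace A | x 0 = a} (fun _ => (1 : ℝ)) x ∂μ =
      ∫ x, φ (cons a (shift x)) * g (cons a (shift x)) ∂μ :=
    (integral_condExp hm).symm.trans
      (integral_congr_ae (hpull.trans ((h.condExp_eq a).mono fun x hx => by
        simp only [Pi.mul_apply]; rw [hx])))
  rw [hcond]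
  conv_lhs => rw [← h.invariant.map_eq]
  rw [integral_map measurable_shift.aemeasurable
    (Continuous.measurable (by fun_prop)).aestronglyMeasurable]
  simp only [mul_comm]

/-- A probability measure that is invariant under the transfer operator of `g` is a
`g`-measure. -/
lemma isGMeasure_of_integral_transfer {g : C(PastSpace A, ℝ)} (hg : IsGFunction g)
    {μ : Measure (PastSpace A)} [IsProbabilityMeasure μ]
    (h : ∀ φ : PastSpace A → ℝ, Continuous φ →
      ∫ x, ∑ a, g (cons a x) * φ (cons a x) ∂μ = ∫ x, φ x ∂μ) : IsGMeasure g μ := by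
  classical
  -- The transfer operator sends `φ ∘ shift` to `φ`, because the weights sum to one.
  have hinv : MeasurePreserving shift μ μ := by
    refine ⟨measurable_shift, ?_⟩
    have := Measure.isProbabilityMeasure_map (μ := μ) (measurable_shift (A := A)).aemeasurable
    refine measure_eq_of_integral_eq fun φ hφ => ?_
    rw [integral_map measurable_shift.aemeasurable hφ.measurable.aestronglyMeasurable,
      ← h (fun x => φ (shift x)) (by fun_prop)]
    simp only [shift_cons, ← Finset.sum_mul, hg.sum_eq_one, one_mul]
  refine ⟨inferInstance, hinv, fun a => ?_⟩
  have hm : MeasurableSpace.comap (shift : PastSpace A → PastSpace A) inferInstance ≤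
      (inferInstance : MeasurableSpace (PastSpace A)) := measurable_shift.comap_le
  have hind := continuous_indicator_of_isClopen (isClopen_coord_eq a)
  have hga : Continuous fun x => g (cons a x) := by fun_prop
  -- This is the conditional probability in integrated form. It follows by testing the hypothesis on
  -- `φ ∘ shift` cut off to `x 0 = a`, where only the letter `a` survives in the sum.
  have key : Measure.map shift (μ.restrict {x : PastSpace A | x 0 = a}) =
      μ.withDensity fun x => ENNReal.ofReal (g (cons a x)) := by
    have : IsFiniteMeasure (μ.withDensity fun x => ENNReal.ofReal (g (cons a x))) :=
      isFiniteMeasure_withDensity_ofReal (integrable_of_continuous μ hga).2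
    refine measure_eq_of_integral_eq fun φ hφ => ?_
    rw [integral_map measurable_shift.aemeasurable hφ.measurable.aestronglyMeasurable,
      ← integral_indicator (isClopen_coord_eq a).isOpen.measurableSet,
      integral_withDensity_eq_integral_toReal_smul (by fun_prop) (by simp)]
    have hclopen : Continuous (Set.indicator {x : PastSpace A | x 0 = a} fun x => φ (shift x)) :=
      (hφ.comp continuous_shift).indicator (by simp [(isClopen_coord_eq a).frontier_eq])
    rw [← h _ hclopen]
    refine integral_congr_ae (ae_of_all _ fun x => ?_)
    simp only [smul_eq_mul]
    rw [Finset.sum_eq_single a, ENNReal.toReal_ofReal (hg.mem_Icc _).1]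
    · rw [Set.indicator_of_mem (by simp), shift_cons]
    · intro b _ hb
      simp [hb]
    · simp
  refine (ae_eq_condExp_of_forall_setIntegral_eq hm (integrable_of_continuous μ hind)
    (fun s _ _ => (integrable_of_continuous μ (by fun_prop)).integrableOn) ?_ ?_).symm
  · rintro s ⟨B, hB, rfl⟩ -
    have hreal := congrArg (fun ν : Measure (PastSpace A) => ∫ _ in B, (1 : ℝ) ∂ν) key
    rw [setIntegral_map hB (by fun_prop) measurable_shift.aemeasurable,
      setIntegral_withDensity_eq_setIntegral_toReal_smul (by fun_prop) (by simp) _ hB] at hreal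
    simp only [ENNReal.toReal_ofReal (hg.mem_Icc _).1, smul_eq_mul, mul_one] at hreal
    conv_lhs => rw [← setIntegral_map (g := shift) (f := fun x => g (cons a x)) hB
      hga.measurable.aestronglyMeasurable measurable_shift.aemeasurable, hinv.map_eq]
    rw [← hreal, Measure.restrict_restrict (measurable_shift hB),
      setIntegral_indicator (isClopen_coord_eq a).isOpen.measurableSet]
  · exact (hga.measurable.comp
      (comap_measurable
        (shift : PastSpace A → PastSpace A))).stronglyMeasurable.aestronglyMeasurable

end TransferOperator

/-! ### Couplings and the `d̄`-distance -/

section DBar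

/-- The set of pairs of pasts that differ at time `-n` is clopen. -/
lemma isClopen_coord_ne {A : Type} [TopologicalSpace A] [DiscreteTopology A] (n : ℕ) :
    IsClopen {z : PastSpace A × PastSpace A | z.1 n ≠ z.2 n} :=
  (isClopen_discrete {p : A × A | p.1 ≠ p.2}).preimage
    (f := fun z : PastSpace A × PastSpace A => (z.1 n, z.2 n)) (by fun_prop)

lemma continuous_prodMap_shift {A : Type} [TopologicalSpace A] :
    Continuous (Prod.map shift shift : PastSpace A × PastSpace A → PastSpace A × PastSpace A) :=
  continuous_shift.prodMap continuous_shift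

lemma stationaryCouplings.isProbabilityMeasure {A : Type} [MeasurableSpace A]
    {μ μ' : Measure (PastSpace A)} [IsProbabilityMeasure μ]
    {ν : Measure (PastSpace A × PastSpace A)} (h : ν ∈ stationaryCouplings μ μ') :
    IsProbabilityMeasure ν :=
  ⟨by rw [← Measure.fst_univ, h.1, measure_univ]⟩

variable {A : Type} [Finite A] [TopologicalSpace A] [DiscreteTopology A] [MeasurableSpace A]
  [BorelSpace A]

lemma measurableSet_coord_ne (n : ℕ) :
    MeasurableSet {z : PastSpace A × PastSpace A | z.1 n ≠ z.2 n} :=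
  (isClopen_coord_ne n).isOpen.measurableSet

/-- Any coupling of invariant measures bounds `d̄`, provided that the probability of a discrepancy
is bounded uniformly in time. -/
lemma dbar_le_of_coupling {μ μ' : Measure (PastSpace A)}
    (hμ : MeasurePreserving shift μ μ) (hμ' : MeasurePreserving shift μ' μ')
    (ρ : Measure (PastSpace A × PastSpace A)) [IsProbabilityMeasure ρ] (h1 : ρ.fst = μ)
    (h2 : ρ.snd = μ') {c : ℝ≥0∞} (hc : ∀ n, ρ {z | z.1 n ≠ z.2 n} ≤ c) : dbar μ μ' ≤ c := by
  rcases eq_or_ne c ∞ with rfl | hctop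
  · exact le_top
  let S : PastSpace A × PastSpace A → PastSpace A × PastSpace A := Prod.map shift shift
  have hS : Continuous S := continuous_prodMap_shift
  have hSm : ∀ m, Continuous S^[m] := hS.iterate
  -- Averaging the shifted copies of `ρ` makes the coupling stationary. The marginals do not move,
  -- since they are already invariant.
  let r : ℕ → Measure (PastSpace A × PastSpace A) := fun m => ρ.map S^[m]
  have hr : ∀ m, IsProbabilityMeasure (r m) := fun m =>
    Measure.isProbabilityMeasure_map (hSm m).measurable.aemeasurable
  have hrint : ∀ m (φ : PastSpace A × PastSpace A → ℝ), Continuous φ →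
      ∫ z, φ z ∂r m = ∫ z, φ (S^[m] z) ∂ρ := fun m φ hφ =>
    integral_map (hSm m).measurable.aemeasurable hφ.measurable.aestronglyMeasurable
  obtain ⟨ν, hν, hinv, hle⟩ := exists_average_limit r
  have heq : ∀ (φ : PastSpace A × PastSpace A → ℝ) (c : ℝ), Continuous φ →
      (∀ m, ∫ z, φ z ∂r m = c) → ∫ z, φ z ∂ν = c := by
    intro φ c hφ h
    refine le_antisymm (hle φ c hφ fun m => (h m).le) ?_
    have := hle (fun z => -φ z) (-c) hφ.neg fun m => by rw [integral_neg, h]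
    rw [integral_neg] at this
    linarith
  have hfst : ν.fst = μ := by
    have : IsProbabilityMeasure μ := h1 ▸ inferInstance
    refine measure_eq_of_integral_eq fun φ hφ => ?_
    rw [Measure.fst, integral_map measurable_fst.aemeasurable
      hφ.measurable.aestronglyMeasurable]
    refine heq _ _ (hφ.comp continuous_fst) fun m => ?_
    rw [hrint m (fun z => φ z.1) (hφ.comp continuous_fst)]
    simp only [S, Prod.map_iterate, Prod.map_fst]
    conv_rhs => rw [← (hμ.iterate m).map_eq, ← h1, Measure.fst,
      Measure.map_map (hμ.iterate m).measurable measurable_fst]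
    rw [integral_map ((hμ.iterate m).measurable.comp measurable_fst).aemeasurable
      hφ.measurable.aestronglyMeasurable]
    rfl
  have hsnd : ν.snd = μ' := by
    have : IsProbabilityMeasure μ' := h2 ▸ inferInstance
    refine measure_eq_of_integral_eq fun φ hφ => ?_
    rw [Measure.snd, integral_map measurable_snd.aemeasurable
      hφ.measurable.aestronglyMeasurable]
    refine heq _ _ (hφ.comp continuous_snd) fun m => ?_
    rw [hrint m (fun z => φ z.2) (hφ.comp continuous_snd)]
    simp only [S, Prod.map_iterate, Prod.map_snd]
    conv_rhs => rw [← (hμ'.iterate m).map_eq, ← h2, Measure.snd,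
      Measure.map_map (hμ'.iterate m).measurable measurable_snd]
    rw [integral_map ((hμ'.iterate m).measurable.comp measurable_snd).aemeasurable
      hφ.measurable.aestronglyMeasurable]
    rfl
  have hpres : MeasurePreserving S ν ν := by
    refine ⟨hS.measurable, ?_⟩
    have := Measure.isProbabilityMeasure_map (μ := ν) hS.measurable.aemeasurable
    refine measure_eq_of_integral_eq fun φ hφ => ?_
    rw [integral_map hS.measurable.aemeasurable hφ.measurable.aestronglyMeasurable]
    refine (hinv φ (fun z => φ (S z)) hφ (hφ.comp hS) fun m => ?_).symm
    rw [hrint _ _ hφ, hrint m (fun z => φ (S z)) (hφ.comp hS)]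
    simp only [Function.iterate_succ_apply']
  refine (iInf₂_le ν ⟨hfst, hsnd, hpres⟩).trans ?_
  rw [← ENNReal.toReal_le_toReal (by finiteness) hctop]
  change ν.real {z | z.1 0 ≠ z.2 0} ≤ c.toReal
  rw [← integral_indicator_of_isClopen (isClopen_coord_ne 0)]
  refine hle _ _ (continuous_indicator_of_isClopen (isClopen_coord_ne 0)) fun m => ?_
  rw [integral_indicator_of_isClopen (isClopen_coord_ne 0), Measure.real,
    ENNReal.toReal_le_toReal (by finiteness) hctop,
    Measure.map_apply (hSm m).measurable (measurableSet_coord_ne 0)]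
  refine le_of_eq_of_le (congrArg ρ ?_) (hc m)
  ext z
  simp [S, Prod.map_iterate, shift_iterate_apply]

/-- Supplies the bound uniform in time that `dbar_le_of_coupling` requires. -/
lemma stationaryCouplings.measure_coord_ne {μ μ' : Measure (PastSpace A)}
    {ν : Measure (PastSpace A × PastSpace A)} (h : ν ∈ stationaryCouplings μ μ') (n : ℕ) :
    ν {z | z.1 n ≠ z.2 n} = ν {z | z.1 0 ≠ z.2 0} := by
  rw [← (h.2.2.iterate n).measure_preimage
    (measurableSet_coord_ne 0).nullMeasurableSet]
  congr 1
  ext z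
  simp [Prod.map_iterate, shift_iterate_apply]

/-- The triangle inequality for `d̄`. -/
lemma dbar_triangle {μ₁ μ₂ μ₃ : Measure (PastSpace A)} [IsProbabilityMeasure μ₁]
    [IsProbabilityMeasure μ₂] (h₁ : MeasurePreserving shift μ₁ μ₁)
    (h₃ : MeasurePreserving shift μ₃ μ₃) : dbar μ₁ μ₃ ≤ dbar μ₁ μ₂ + dbar μ₂ μ₃ := by
  have key : ∀ ν ∈ stationaryCouplings μ₁ μ₂, ∀ ν' ∈ stationaryCouplings μ₂ μ₃,
      dbar μ₁ μ₃ ≤ ν {z | z.1 0 ≠ z.2 0} + ν' {z | z.1 0 ≠ z.2 0} := by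
    intro ν hν ν' hν'
    have := stationaryCouplings.isProbabilityMeasure hν
    have := stationaryCouplings.isProbabilityMeasure hν'
    have : Nonempty (PastSpace A) := nonempty_of_isProbabilityMeasure μ₁
    -- Gluing: given the shared middle component, the third is drawn from the conditional law of
    -- `ν'`. Stationarity of the result need not be checked, as `dbar_le_of_coupling` restores it by
    -- averaging.
    let κ : ProbabilityTheory.Kernel (PastSpace A × PastSpace A) (PastSpace A) :=
      ν'.condKernel.comap Prod.snd measurable_snd
    let θ := ν.compProd κ
    have hleft : θ.map Prod.fst = ν := Measure.fst_compProd ν κ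
    have hright : θ.map (fun w => (w.1.2, w.2)) = ν' := by
      have : ν.snd.compProd ν'.condKernel = ν' := by
        rw [hν.2.1, ← hν'.1]; exact ν'.disintegrate _
      have hmeas : Measurable fun w : (PastSpace A × PastSpace A) × PastSpace A => (w.1.2, w.2) := by
        fun_prop
      refine Measure.ext fun s hs => ?_
      rw [Measure.map_apply hmeas hs, Measure.compProd_apply (hmeas hs)]
      conv_rhs => rw [← this, Measure.compProd_apply hs, Measure.snd,
        lintegral_map (ProbabilityTheory.Kernel.measurable_kernel_prodMk_left hs) measurable_snd]
      rfl
    have hpair : Measurable fun w : (PastSpace A × PastSpace A) × PastSpace A => (w.1.1, w.2) := by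
      fun_prop
    have hpair' : Measurable fun w : (PastSpace A × PastSpace A) × PastSpace A => (w.1.2, w.2) := by
      fun_prop
    have := Measure.isProbabilityMeasure_map (μ := θ) hpair.aemeasurable
    refine dbar_le_of_coupling h₁ h₃ (θ.map fun w => (w.1.1, w.2)) ?_ ?_ fun n => ?_
    · rw [← hν.1, ← hleft, Measure.fst, Measure.map_map measurable_fst hpair, Measure.fst,
        Measure.map_map measurable_fst measurable_fst]
      rfl
    · rw [← hν'.2.1, ← hright, Measure.snd, Measure.map_map measurable_snd hpair, Measure.snd,
        Measure.map_map measurable_snd hpair']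
      rfl
    · have hne := measurableSet_coord_ne (A := A) n
      rw [← stationaryCouplings.measure_coord_ne hν n,
        ← stationaryCouplings.measure_coord_ne hν' n, Measure.map_apply hpair hne, ← hleft,
        ← hright, Measure.map_apply measurable_fst hne, Measure.map_apply hpair' hne]
      refine (measure_mono fun w hw => ?_).trans (measure_union_le _ _)
      by_contra hcon
      simp only [Set.mem_union, Set.mem_preimage, Set.mem_ofPred_eq, not_or, not_not] at hcon
      exact hw (hcon.1.trans hcon.2)
  rw [dbar.eq_def μ₁ μ₂, dbar.eq_def μ₂ μ₃]
  simp only [ENNReal.iInf_add, ENNReal.add_iInf]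
  exact le_iInf₂ fun ν hν => le_iInf₂ fun ν' hν' => key ν' hν' ν hν

lemma dbar_self (μ : Measure (PastSpace A)) (h : MeasurePreserving shift μ μ) :
    dbar μ μ = 0 := by
  have hd : Measurable fun x : PastSpace A => (x, x) := measurable_id.prodMk measurable_id
  have hmem : μ.map (fun x => (x, x)) ∈ stationaryCouplings μ μ := by
    refine ⟨?_, ?_, continuous_prodMap_shift.measurable, ?_⟩
    · rw [Measure.fst, Measure.map_map measurable_fst hd]; exact Measure.map_id
    · rw [Measure.snd, Measure.map_map measurable_snd hd]; exact Measure.map_id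
    · rw [Measure.map_map continuous_prodMap_shift.measurable hd]
      conv_rhs => rw [← h.map_eq, Measure.map_map hd measurable_shift]
      rfl
  refine le_antisymm ((iInf₂_le _ hmem).trans ?_) bot_le
  rw [Measure.map_apply hd (measurableSet_coord_ne 0)]
  simp

end DBar

/-! ### Lower semicontinuity of `d̄` and limits of `g`-measures -/

section Convergence

variable {A : Type} [TopologicalSpace A] [DiscreteTopology A] [MeasurableSpace A]
  [BorelSpace A]

/-- Lower semicontinuity of `d̄` along an ultrafilter, in terms of near-optimal couplings. -/
lemma exists_limit_of_dbar_lt [Finite A] {ι : Type*} (U : Ultrafilter ι)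
    {μ : Measure (PastSpace A)} [IsProbabilityMeasure μ] (μs : ι → Measure (PastSpace A))
    {c : ℝ≥0∞} (h : ∀ n, dbar μ (μs n) < c) :
    ∃ ν : Measure (PastSpace A), IsProbabilityMeasure ν ∧ dbar μ ν ≤ c ∧
      ∀ φ : PastSpace A → ℝ, Continuous φ →
        Tendsto (fun n => ∫ x, φ x ∂μs n) U (𝓝 (∫ x, φ x ∂ν)) := by
  -- The strict bound yields actual couplings without knowing that the infimum is attained. The
  -- limit is taken on the product space, and its second marginal is the measure sought.
  have hex : ∀ n, ∃ ρ ∈ stationaryCouplings μ (μs n), ρ {z | z.1 0 ≠ z.2 0} < c := by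
    intro n
    simpa only [dbar, iInf_lt_iff, exists_prop] using h n
  choose ρ hρ hρc using hex
  have hprob := fun n => stationaryCouplings.isProbabilityMeasure (hρ n)
  obtain ⟨ν, hν, hlim⟩ := exists_tendsto_integral U ρ
  have hfst : ν.fst = μ := by
    refine measure_eq_of_integral_eq fun φ hφ => ?_
    rw [Measure.fst, integral_map measurable_fst.aemeasurable hφ.measurable.aestronglyMeasurable]
    refine tendsto_nhds_unique (hlim _ (hφ.comp continuous_fst)) ?_
    refine tendsto_const_nhds.congr fun n => ?_
    rw [← (hρ n).1, Measure.fst, integral_map measurable_fst.aemeasurable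
      hφ.measurable.aestronglyMeasurable]
  have hS := continuous_prodMap_shift (A := A)
  have hpres : MeasurePreserving (Prod.map shift shift) ν ν := by
    refine ⟨hS.measurable, ?_⟩
    have := Measure.isProbabilityMeasure_map (μ := ν) hS.measurable.aemeasurable
    refine measure_eq_of_integral_eq fun φ hφ => ?_
    rw [integral_map hS.measurable.aemeasurable hφ.measurable.aestronglyMeasurable]
    refine tendsto_nhds_unique (hlim _ (hφ.comp hS)) ((hlim φ hφ).congr fun n => ?_)
    conv_lhs => rw [← (hρ n).2.2.map_eq]
    rw [integral_map hS.measurable.aemeasurable hφ.measurable.aestronglyMeasurable]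
  refine ⟨ν.snd, inferInstance, ?_, fun φ hφ => ?_⟩
  · rcases eq_or_ne c ∞ with rfl | hctop
    · exact le_top
    refine (iInf₂_le ν ⟨hfst, rfl, hpres⟩).trans ?_
    rw [← ENNReal.toReal_le_toReal (by finiteness) hctop]
    change ν.real {z | z.1 0 ≠ z.2 0} ≤ c.toReal
    rw [← integral_indicator_of_isClopen (isClopen_coord_ne 0)]
    refine le_of_tendsto (hlim _ (continuous_indicator_of_isClopen (isClopen_coord_ne 0)))
      (Eventually.of_forall fun n => ?_)
    rw [integral_indicator_of_isClopen (isClopen_coord_ne 0), Measure.real,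
      ENNReal.toReal_le_toReal (by finiteness) hctop]
    exact (hρc n).le
  · rw [Measure.snd, integral_map measurable_snd.aemeasurable
      hφ.measurable.aestronglyMeasurable]
    refine (hlim _ (hφ.comp continuous_snd)).congr fun n => ?_
    rw [← (hρ n).2.1, Measure.snd, integral_map measurable_snd.aemeasurable
      hφ.measurable.aestronglyMeasurable]
    rfl

/-- A weak limit of `Gₙ`-measures is a `g`-measure if `Gₙ` converges uniformly to `g`. -/
lemma isGMeasure_of_tendsto [Fintype A] {ι : Type*} {U : Filter ι} [U.NeBot]
    {g : C(PastSpace A, ℝ)} (hg : IsGFunction g) {G : ι → C(PastSpace A, ℝ)}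
    (hG : Tendsto G U (𝓝 g)) {μs : ι → Measure (PastSpace A)}
    (hμs : ∀ n, IsGMeasure (G n) (μs n)) {ν : Measure (PastSpace A)} [IsProbabilityMeasure ν]
    (hlim : ∀ φ : PastSpace A → ℝ, Continuous φ →
      Tendsto (fun n => ∫ x, φ x ∂μs n) U (𝓝 (∫ x, φ x ∂ν))) : IsGMeasure g ν := by
  refine isGMeasure_of_integral_transfer hg fun φ hφ => ?_
  obtain ⟨C, hC⟩ := isCompact_univ.exists_bound_of_continuousOn hφ.continuousOn
  -- Each `μs n` is exactly invariant for its own kernel, so its defect for `g` is controlled by the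
  -- uniform distance of the kernels alone.
  have hbound : ∀ n, ‖∫ x, φ x ∂μs n - ∫ x, ∑ a, g (cons a x) * φ (cons a x) ∂μs n‖ ≤
      Fintype.card A * (‖G n - g‖ * C) := by
    intro n
    have := (hμs n).isProbabilityMeasure
    rw [← (hμs n).integral_transfer hφ, ← integral_sub
      (integrable_of_continuous _ (by fun_prop)) (integrable_of_continuous _ (by fun_prop))]
    refine (norm_integral_le_of_norm_le_const (C := Fintype.card A * (‖G n - g‖ * C))
      (ae_of_all _ fun x => ?_)).trans (by simp)
    rw [← Finset.sum_sub_distrib]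
    refine (norm_sum_le _ _).trans ?_
    calc _ ≤ ∑ _a : A, ‖G n - g‖ * C := Finset.sum_le_sum fun a _ => by
          rw [← sub_mul, norm_mul]
          exact mul_le_mul ((G n - g).norm_coe_le_norm (cons a x)) (hC _ (Set.mem_univ _))
            (norm_nonneg _) (norm_nonneg _)
      _ = _ := by simp
  have hzero : Tendsto (fun n => Fintype.card A * (‖G n - g‖ * C)) U (𝓝 0) := by
    have := (((tendsto_iff_norm_sub_tendsto_zero.1 hG).mul_const C).const_mul
      (Fintype.card A : ℝ))
    simpa using this
  have := tendsto_nhds_unique ((hlim φ hφ).sub (hlim _ (by fun_prop : Continuous fun x =>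
    ∑ a, g (cons a x) * φ (cons a x)))) (squeeze_zero_norm hbound hzero)
  linarith

/-- If the `d̄`-increments of a sequence of `Gₙ`-measures are summable and `Gₙ` converges to `g`,
then the sequence stays `d̄`-close to some `g`-measure. -/
lemma exists_isGMeasure_dbar_le [Fintype A] {g : C(PastSpace A, ℝ)} (hg : IsGFunction g)
    {G : ℕ → C(PastSpace A, ℝ)} (hG : Tendsto G atTop (𝓝 g)) {μ : ℕ → Measure (PastSpace A)}
    (hμ : ∀ n, IsGMeasure (G n) (μ n)) (k : ℕ) {c : ℝ≥0∞}
    (hc : ∑' j : ℕ, dbar (μ (k + j)) (μ (k + j + 1)) < c) :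
    ∃ ν, IsGMeasure g ν ∧ dbar (μ k) ν ≤ c := by
  have := fun n => (hμ n).isProbabilityMeasure
  have hpartial : ∀ n, dbar (μ k) (μ (k + n)) ≤
      ∑ j ∈ Finset.range n, dbar (μ (k + j)) (μ (k + j + 1)) := by
    intro n
    induction n with
    | zero => simp [dbar_self _ (hμ k).invariant]
    | succ n ih =>
      rw [Finset.sum_range_succ]
      exact (dbar_triangle (hμ k).invariant (hμ _).invariant).trans (by gcongr; rfl)
  obtain ⟨ν, hν, hdbar, hlim⟩ := exists_limit_of_dbar_lt (hyperfilter ℕ)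
    (fun n => μ (k + n)) (fun n => ((hpartial n).trans (ENNReal.sum_le_tsum _)).trans_lt hc)
  refine ⟨ν, isGMeasure_of_tendsto hg (G := fun n => G (k + n)) ?_ (fun n => hμ (k + n)) hlim,
    hdbar⟩
  have : Tendsto (fun n => k + n) atTop atTop := tendsto_atTop_mono (Nat.le_add_left · k) tendsto_id
  exact (hG.comp this).mono_left Nat.hyperfilter_le_atTop

lemma dbar_comm_le (μ μ' : Measure (PastSpace A)) [Finite A] : dbar μ μ' ≤ dbar μ' μ := by
  refine le_iInf₂ fun ν hν => ?_
  have hswap : Measurable (Prod.swap : PastSpace A × PastSpace A → _) := measurable_swap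
  have hS := (continuous_prodMap_shift (A := A)).measurable
  have hmem : ν.map Prod.swap ∈ stationaryCouplings μ μ' := by
    refine ⟨by rw [Measure.fst_map_swap, hν.2.1], by rw [Measure.snd_map_swap, hν.1], hS, ?_⟩
    rw [Measure.map_map hS hswap]
    conv_rhs => rw [← hν.2.2.map_eq, Measure.map_map hswap hS]
    rfl
  refine (iInf₂_le _ hmem).trans ?_
  rw [Measure.map_apply hswap (measurableSet_coord_ne 0)]
  exact measure_mono fun z hz h => hz h.symm

/-- Two sequences of `Gₙ`-measures whose total `d̄`-increments do not bridge their `d̄`-distance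
lead to distinct `g`-measures. -/
theorem exists_ne_of_tsum_dbar_lt [Fintype A] {g : C(PastSpace A, ℝ)} (hg : IsGFunction g)
    {G G' : ℕ → C(PastSpace A, ℝ)} (hG : Tendsto G atTop (𝓝 g)) (hG' : Tendsto G' atTop (𝓝 g))
    {μ μ' : ℕ → Measure (PastSpace A)} (hμ : ∀ n, IsGMeasure (G n) (μ n))
    (hμ' : ∀ n, IsGMeasure (G' n) (μ' n)) {k : ℕ}
    (h : (∑' j : ℕ, dbar (μ (k + j)) (μ (k + j + 1))) +
      (∑' j : ℕ, dbar (μ' (k + j)) (μ' (k + j + 1))) < dbar (μ k) (μ' k)) :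
    ∃ ν ν' : Measure (PastSpace A), IsGMeasure g ν ∧ IsGMeasure g ν' ∧ ν ≠ ν' := by
  by_contra! hcon
  refine h.not_ge (ENNReal.le_of_forall_pos_le_add fun ε hε hfin => ?_)
  -- `exists_isGMeasure_dbar_le` needs a strict upper bound for each sum, so each one receives half
  -- of the slack.
  have hε2 : ((ε / 2 : NNReal) : ℝ≥0∞) ≠ 0 := by simpa using (half_pos hε).ne'
  obtain ⟨hfin1, hfin2⟩ := ENNReal.add_lt_top.1 hfin
  obtain ⟨ν, hν, hle⟩ := exists_isGMeasure_dbar_le hg hG hμ k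
    (ENNReal.lt_add_right hfin1.ne hε2)
  obtain ⟨ν', hν', hle'⟩ := exists_isGMeasure_dbar_le hg hG' hμ' k
    (ENNReal.lt_add_right hfin2.ne hε2)
  obtain rfl := hcon ν ν' hν hν'
  have := (hμ k).isProbabilityMeasure
  have := hν.isProbabilityMeasure
  refine (dbar_triangle (hμ k).invariant (hμ' k).invariant (μ₂ := ν)).trans ?_
  refine (add_le_add hle ((dbar_comm_le _ _).trans hle')).trans (le_of_eq ?_)
  rw [add_add_add_comm, ← ENNReal.coe_add, add_halves]

end Convergence

/-! ### The two-letter alphabet -/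

/-- The letter `+1`. -/
def up : Spin := ⟨1, by decide⟩

/-- The letter `-1`. -/
def down : Spin := ⟨-1, by decide⟩

lemma down_ne_up : down ≠ up := by decide

lemma univ_spin : (Finset.univ : Finset Spin) = {up, down} := by decide

lemma eq_up_or_eq_down (a : Spin) : a = up ∨ a = down := by
  have := Finset.mem_univ a
  rw [univ_spin] at this
  simpa using this

lemma le_up (a : Spin) : a ≤ up := by revert a; decide

lemma down_le (a : Spin) : down ≤ a := by revert a; decide

lemma eq_down_of_ne_up {a : Spin} (h : a ≠ up) : a = down := (eq_up_or_eq_down a).resolve_left h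

lemma eq_up_of_up_le {a : Spin} (h : up ≤ a) : a = up := le_antisymm (le_up a) h

lemma sum_spin (f : Spin → ℝ) : ∑ a, f a = f up + f down := by
  rw [univ_spin, Finset.sum_pair down_ne_up.symm]

lemma Attractive.monotone_up {g : PastSpace Spin → ℝ} (h : Attractive g) :
    Monotone fun x => g (cons up x) := by
  have hs : (Finset.univ.filter fun b : Spin => up ≤ b) = {up} := by decide
  have := h up
  simpa only [hs, Finset.sum_singleton] using this

lemma IsGFunction.apply_cons_down {g : PastSpace Spin → ℝ} (h : IsGFunction g)
    (x : PastSpace Spin) : g (cons down x) = 1 - g (cons up x) := by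
  have := h.sum_eq_one x
  rw [sum_spin] at this
  linarith

/-! ### The monotone coupling by a common threshold -/

section Step

variable {I : Type*}

/-- Simultaneous update of the pasts `ω i` with a common threshold `u`: the letter `+1` is emitted
in the component `i` if `u` is at most its conditional probability `h i`. -/
def step (h : I → C(PastSpace Spin, ℝ)) (p : ℝ × (I → PastSpace Spin)) : I → PastSpace Spin :=
  fun i => cons (if p.1 ≤ h i (cons up (p.2 i)) then up else down) (p.2 i)

/-- The uniform distribution on `(0, 1]`. -/
def unif : Measure ℝ := volume.restrict (Set.Ioc 0 1)

instance : IsProbabilityMeasure unif := ⟨by simp [unif]⟩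

lemma measurable_step (h : I → C(PastSpace Spin, ℝ)) : Measurable (step h) := by
  refine measurable_pi_lambda _ fun i => ?_
  have hp : Measurable fun p : ℝ × (I → PastSpace Spin) => p.2 i :=
    (measurable_pi_apply i).comp measurable_snd
  have hs : MeasurableSet {p : ℝ × (I → PastSpace Spin) | p.1 ≤ h i (cons up (p.2 i))} :=
    measurableSet_le measurable_fst
      (((h i).continuous.comp (continuous_cons up)).measurable.comp hp)
  have hcons : ∀ a : Spin, Measurable fun p : ℝ × (I → PastSpace Spin) => cons a (p.2 i) :=
    fun a => (continuous_cons a).measurable.comp hp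
  have : (fun p : ℝ × (I → PastSpace Spin) => step h p i) = fun p =>
      if p.1 ≤ h i (cons up (p.2 i)) then cons up (p.2 i) else cons down (p.2 i) := by
    funext p
    simp only [step]
    split_ifs <;> rfl
  rw [this]
  exact Measurable.ite hs (hcons up) (hcons down)

/-- A shared threshold that makes the lower component emit `+1` does the same for the upper one.
Comparing the kernels across ordered pasts covers both attractiveness and the passage from one
kernel to another. -/
lemma step_mono {h : I → C(PastSpace Spin, ℝ)} {i j : I}
    (hij : ∀ x x', x' ≤ x → h j (cons up x') ≤ h i (cons up x))
    {p : ℝ × (I → PastSpace Spin)} (hp : p.2 j ≤ p.2 i) : step h p j ≤ step h p i := by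
  intro n
  cases n with
  | zero =>
    simp only [step, cons_zero]
    split_ifs with h1 h2
    · exact le_rfl
    · exact absurd (h1.trans (hij _ _ hp)) h2
    · exact down_le _
    · exact le_rfl
  | succ n => exact hp n

lemma integral_unif_threshold {q : ℝ} (hq : q ∈ Set.Icc (0 : ℝ) 1) (φ : Spin → ℝ) :
    ∫ u, φ (if u ≤ q then up else down) ∂unif = q * φ up + (1 - q) * φ down := by
  have hfun : (fun u : ℝ => φ (if u ≤ q then up else down)) =
      fun u => (Set.Iic q).indicator (fun _ => φ up - φ down) u + φ down := by
    funext u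
    by_cases hu : u ≤ q <;> simp [hu]
  have hset : Set.Ioc (0 : ℝ) 1 ∩ Set.Iic q = Set.Ioc 0 q := by
    ext u
    simp only [Set.mem_inter_iff, Set.mem_Ioc, Set.mem_Iic]
    exact ⟨fun h => ⟨h.1.1, h.2⟩, fun h => ⟨⟨h.1, h.2.trans hq.2⟩, h.2⟩⟩
  rw [hfun, integral_add ((integrable_const _).indicator measurableSet_Iic) (integrable_const _),
    integral_indicator measurableSet_Iic, unif, Measure.restrict_restrict measurableSet_Iic,
    Set.inter_comm, hset]
  simp [hq.1]
  ring

variable [Countable I]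

instance : BorelSpace (I → PastSpace Spin) := Pi.borelSpace

/-- Integrating out the threshold first shows that each marginal evolves by its own kernel, whatever
the dependence between components. -/
lemma integral_map_step {h : I → C(PastSpace Spin, ℝ)} (hh : ∀ i, IsGFunction (h i))
    (ν : Measure (I → PastSpace Spin)) [IsProbabilityMeasure ν] (i : I)
    {φ : PastSpace Spin → ℝ} (hφ : Continuous φ) :
    ∫ ω, φ (ω i) ∂((unif.prod ν).map (step h)) =
      ∫ ω, ∑ a, h i (cons a (ω i)) * φ (cons a (ω i)) ∂ν := by
  have hφi : Continuous fun ω : I → PastSpace Spin => φ (ω i) := hφ.comp (continuous_apply i)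
  obtain ⟨C, hC⟩ := isCompact_univ.exists_bound_of_continuousOn hφ.continuousOn
  rw [integral_map (measurable_step h).aemeasurable hφi.measurable.aestronglyMeasurable,
    integral_prod_symm (fun p => φ (step h p i)) (Integrable.of_bound
      (hφi.measurable.comp (measurable_step h)).aestronglyMeasurable C
      (ae_of_all _ fun p => hC _ (Set.mem_univ _)))]
  refine integral_congr_ae (ae_of_all _ fun ω => ?_)
  simp only [step]
  rw [integral_unif_threshold ((hh i).mem_Icc _) fun a => φ (cons a (ω i)), sum_spin,
    (hh i).apply_cons_down]

/-- Any family of continuous `g`-functions has a joint shift-invariant coupling of associated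
`g`-measures, which respects the order between components, and which may be required to have
given `g`-measures as some of its marginals. -/
theorem exists_monotone_coupling (h : I → C(PastSpace Spin, ℝ)) (hh : ∀ i, IsGFunction (h i))
    (ν₀ : Measure (I → PastSpace Spin)) [IsProbabilityMeasure ν₀] :
    ∃ ν : Measure (I → PastSpace Spin), IsProbabilityMeasure ν ∧
      MeasurePreserving (fun ω i => shift (ω i)) ν ν ∧
      (∀ i, IsGMeasure (h i) (ν.map fun ω => ω i)) ∧
      (∀ i, IsGMeasure (h i) (ν₀.map fun ω => ω i) →
        ν.map (fun ω => ω i) = ν₀.map fun ω => ω i) ∧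
      ∀ i j, (∀ x x', x' ≤ x → h j (cons up x') ≤ h i (cons up x)) →
        (∀ᵐ ω ∂ν₀, ω j ≤ ω i) → ∀ᵐ ω ∂ν, ω j ≤ ω i := by
  let r : ℕ → Measure (I → PastSpace Spin) := fun m =>
    (fun ν => (unif.prod ν).map (step h))^[m] ν₀
  have hr_succ : ∀ m, r (m + 1) = (unif.prod (r m)).map (step h) := fun m =>
    Function.iterate_succ_apply' _ m ν₀
  have hr : ∀ m, IsProbabilityMeasure (r m) := by
    intro m
    induction m with
    | zero => assumption
    | succ m ih =>
      rw [hr_succ]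
      exact Measure.isProbabilityMeasure_map (measurable_step h).aemeasurable
  obtain ⟨ν, hν, hinv, hle⟩ := exists_average_limit r
  have hev : ∀ i, Measurable fun ω : I → PastSpace Spin => ω i := measurable_pi_apply
  have hmarg : ∀ i, IsGMeasure (h i) (ν.map fun ω => ω i) := by
    intro i
    have := Measure.isProbabilityMeasure_map (μ := ν) (hev i).aemeasurable
    refine isGMeasure_of_integral_transfer (hh i) fun φ hφ => ?_
    have hT : Continuous fun x => ∑ a, h i (cons a x) * φ (cons a x) := by fun_prop
    rw [integral_map (hev i).aemeasurable hφ.measurable.aestronglyMeasurable,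
      integral_map (hev i).aemeasurable hT.measurable.aestronglyMeasurable]
    exact (hinv _ _ (hφ.comp (continuous_apply i)) (hT.comp (continuous_apply i)) fun m => by
      rw [hr_succ]; exact integral_map_step hh (r m) i hφ).symm
  refine ⟨ν, hν, ?_, hmarg, fun i hi => ?_, fun i j hij h₀ => ?_⟩
  · have hS : Continuous fun (ω : I → PastSpace Spin) i => shift (ω i) := by fun_prop
    refine ⟨hS.measurable, ?_⟩
    have := Measure.isProbabilityMeasure_map (μ := ν) hS.measurable.aemeasurable
    refine measure_eq_of_integral_eq fun φ hφ => ?_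
    rw [integral_map hS.measurable.aemeasurable hφ.measurable.aestronglyMeasurable]
    refine hinv _ _ (hφ.comp hS) hφ fun m => ?_
    rw [hr_succ, integral_map (f := fun ω : I → PastSpace Spin => φ fun i => shift (ω i))
      (measurable_step h).aemeasurable (hφ.comp hS).measurable.aestronglyMeasurable]
    -- The shift undoes a step, so shifting the law at time `m + 1` gives the law at time `m`.
    have : ∀ p, φ (fun i => shift (step h p i)) = φ p.2 := fun p => rfl
    simp only [this]
    rw [integral_fun_snd]
    simp
  · have := hi.isProbabilityMeasure
    have := (hmarg i).isProbabilityMeasure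
    have hconst : ∀ m, (r m).map (fun ω => ω i) = ν₀.map fun ω => ω i := by
      intro m
      induction m with
      | zero => rfl
      | succ m ih =>
        have := Measure.isProbabilityMeasure_map (μ := r (m + 1)) (hev i).aemeasurable
        refine measure_eq_of_integral_eq fun φ hφ => ?_
        have hT : Continuous fun x => ∑ a, h i (cons a x) * φ (cons a x) := by fun_prop
        rw [integral_map (hev i).aemeasurable hφ.measurable.aestronglyMeasurable, hr_succ,
          integral_map_step hh (r m) i hφ, ← hi.integral_transfer hφ, ← ih,
          integral_map (hev i).aemeasurable hT.measurable.aestronglyMeasurable]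
    refine measure_eq_of_integral_eq fun φ hφ => ?_
    have hφi : Continuous fun ω : I → PastSpace Spin => φ (ω i) := hφ.comp (continuous_apply i)
    have hc : ∀ m, ∫ ω, φ (ω i) ∂r m = ∫ x, φ x ∂(ν₀.map fun ω => ω i) := fun m => by
      rw [← hconst m, integral_map (hev i).aemeasurable hφ.measurable.aestronglyMeasurable]
    rw [integral_map (hev i).aemeasurable hφ.measurable.aestronglyMeasurable]
    refine le_antisymm (hle _ _ hφi fun m => (hc m).le) ?_
    have := hle (fun ω => -φ (ω i)) (-∫ x, φ x ∂(ν₀.map fun ω => ω i)) hφi.neg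
      fun m => by rw [integral_neg, hc]
    rw [integral_neg] at this
    linarith
  · have hord : ∀ m, ∀ᵐ ω ∂r m, ω j ≤ ω i := by
      intro m
      induction m with
      | zero => exact h₀
      | succ m ih =>
        rw [hr_succ, ae_map_iff (measurable_step h).aemeasurable
          (isClosed_le (continuous_apply j) (continuous_apply i)).measurableSet]
        exact (Measure.quasiMeasurePreserving_snd.ae ih).mono fun p hp => step_mono hij hp
    -- The full order is in general only a closed condition. Its violation at one coordinate is
    -- clopen, so it has a continuous indicator and passes to the limit.
    have hcoord : ∀ n, ∀ᵐ ω ∂ν, ω j n ≤ ω i n := by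
      intro n
      have hclopen : IsClopen {ω : I → PastSpace Spin | ¬ ω j n ≤ ω i n} :=
        (isClopen_discrete {p : Spin × Spin | ¬ p.1 ≤ p.2}).preimage
          (f := fun ω : I → PastSpace Spin => (ω j n, ω i n)) (by fun_prop)
      have := hle _ 0 (continuous_indicator_of_isClopen hclopen) fun m => by
        rw [integral_indicator_of_isClopen hclopen]
        have : r m {ω | ¬ ω j n ≤ ω i n} = 0 :=
          (hord m).mono fun ω hω => hω n
        rw [Measure.real, this, ENNReal.toReal_zero]
      rw [integral_indicator_of_isClopen hclopen] at this
      exact (measureReal_eq_zero_iff).1 (le_antisymm this measureReal_nonneg)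
    exact (ae_all_iff.2 hcoord).mono fun ω hω n => hω n

end Step

/-! ### Primitivity of positive finite-order chains -/

section Markov

variable {A : Type}

lemma pushWord_restrict (n : ℕ) (x : PastSpace A) :
    pushWord (x 0) (fun i : Fin n => x (i + 1)) = fun i : Fin n => x i := by
  have : (Fin.cons (x 0) (fun i : Fin n => x (i + 1)) : Fin (n + 1) → A) =
      fun i : Fin (n + 1) => x i := by
    funext i
    refine Fin.cases rfl (fun i => ?_) i
    simp
  funext i
  simp only [pushWord, this, Fin.val_castSucc]

variable [Fintype A] [DecidableEq A]

lemma transitionMatrix_nonneg {k : ℕ} {p : (Fin k → A) → A → ℝ} (hp : ∀ w a, 0 ≤ p w a)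
    (w w' : Fin k → A) : 0 ≤ transitionMatrix p w w' :=
  Finset.sum_nonneg fun a _ => by split_ifs <;> simp [hp]

lemma transitionMatrix_pos {k : ℕ} {p : (Fin k → A) → A → ℝ} (hp : ∀ w a, 0 < p w a)
    (w : Fin k → A) (a : A) : 0 < transitionMatrix p w (pushWord a w) :=
  Finset.sum_pos' (fun b _ => by split_ifs <;> simp [(hp w b).le])
    ⟨a, Finset.mem_univ a, by simp [hp]⟩

/-- Sliding a window of length `k` along `x` towards time `0` is an admissible path of `m`
transitions, each of positive weight. -/
lemma transitionMatrix_pow_pos {k : ℕ} {p : (Fin k → A) → A → ℝ} (hp : ∀ w a, 0 < p w a)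
    (m : ℕ) (x : PastSpace A) :
    0 < (transitionMatrix p ^ m) (fun i => x (i + m)) fun i => x i := by
  have hnonneg : ∀ m w w', 0 ≤ (transitionMatrix p ^ m) w w' :=
    fun m => Matrix.pow_apply_nonneg (transitionMatrix_nonneg fun w a => (hp w a).le) m
  induction m with
  | zero => simp
  | succ m ih =>
    rw [pow_succ', Matrix.mul_apply]
    refine Finset.sum_pos' (fun w _ => mul_nonneg
      (transitionMatrix_nonneg (fun w a => (hp w a).le) _ _) (hnonneg _ _ _))
      ⟨fun i => x (i + m), Finset.mem_univ _, mul_pos ?_ ih⟩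
    have h := pushWord_restrict k fun i => x (i + m)
    have hpos := transitionMatrix_pos hp (fun i : Fin k => x (i + 1 + m)) (x (0 + m))
    rw [h] at hpos
    simpa only [add_assoc, add_comm 1 m] using hpos

/-- The chain of a strictly positive kernel of positive order is primitive. -/
lemma isPrimitive_transitionMatrix {k : ℕ} (hk : 0 < k) {p : (Fin k → A) → A → ℝ}
    (hp : ∀ w a, 0 < p w a) : (transitionMatrix p).IsPrimitive := by
  refine ⟨transitionMatrix_nonneg fun w a => (hp w a).le, k, hk, fun w w' => ?_⟩
  let a : A := w ⟨0, hk⟩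
  -- The target `w'` is followed by the source `w`, so `k` emissions replace the whole word. The
  -- letter `a` is a filler beyond both windows.
  let x : PastSpace A := fun i =>
    if h : i < k then w' ⟨i, h⟩ else if h : i - k < k then w ⟨i - k, h⟩ else a
  have h1 : (fun i : Fin k => x (i + k)) = w := by
    funext i
    simp [x]
  have h2 : (fun i : Fin k => x i) = w' := by
    funext i
    simp [x]
  simpa only [h1, h2] using transitionMatrix_pow_pos hp k x

end Markov

/-! ### Markov approximations with a constant boundary condition -/

section Truncate

variable {A : Type}

/-- The past `x`, with all letters but the `n` last ones replaced by `c`. -/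
def truncate (c : A) (n : ℕ) (x : PastSpace A) : PastSpace A := fun i => if i < n then x i else c

/-- Explains the `n + 1` in `markovApprox`: the emitted letter is one of those kept, which leaves a
memory of `n`. -/
lemma truncate_cons (c : A) (n : ℕ) (a : A) (x : PastSpace A) :
    truncate c (n + 1) (cons a x) = cons a (truncate c n x) := by
  funext i
  cases i <;> simp [truncate]

variable [TopologicalSpace A]

@[fun_prop] lemma continuous_truncate (c : A) (n : ℕ) : Continuous (truncate c n) := by
  refine continuous_pi fun i => ?_
  by_cases h : i < n
  · simp only [truncate, h, if_true]; fun_prop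
  · simp only [truncate, h, if_false]; fun_prop

/-- The approximation of `g` of order `n`, with the constant boundary condition `c`. -/
def markovApprox (g : C(PastSpace A, ℝ)) (c : A) (n : ℕ) : C(PastSpace A, ℝ) :=
  g.comp ⟨truncate c (n + 1), continuous_truncate c (n + 1)⟩

lemma markovApprox_cons (g : C(PastSpace A, ℝ)) (c : A) (n : ℕ) (a : A) (x : PastSpace A) :
    markovApprox g c n (cons a x) = g (cons a (truncate c n x)) := by
  rw [← truncate_cons]; rfl

lemma isGFunction_markovApprox [Fintype A] [DiscreteTopology A] [MeasurableSpace A] [BorelSpace A]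
    {g : C(PastSpace A, ℝ)} (hg : IsGFunction g) (c : A) (n : ℕ) :
    IsGFunction (markovApprox g c n) where
  measurable := (markovApprox g c n).continuous.measurable
  mem_Icc x := hg.mem_Icc (truncate c (n + 1) x)
  sum_eq_one x := by simp only [markovApprox_cons, hg.sum_eq_one]

lemma markovApprox_mem_markovKernels [Fintype A] [DecidableEq A] [DiscreteTopology A]
    [MeasurableSpace A] [BorelSpace A] {g : C(PastSpace A, ℝ)} (hg : g ∈ posGFunctions A) (c : A)
    {n : ℕ} (hn : 0 < n) : markovApprox g c n ∈ markovKernels A n := by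
  refine ⟨isGFunction_markovApprox hg.1 c n, fun w a => g (cons a fun i =>
    if h : i < n then w ⟨i, h⟩ else c), fun a x => ?_,
    isPrimitive_transitionMatrix hn fun w a => hg.2 _⟩
  rw [markovApprox_cons]
  simp only [dite_eq_ite]
  rfl

/-- By compactness `g` is uniformly continuous, and truncations tend uniformly to the identity:
coordinate `i` is exact once `i ≤ n`, for all pasts at once. -/
lemma tendsto_markovApprox [Finite A] [DiscreteTopology A] (g : C(PastSpace A, ℝ)) (c : A) :
    Tendsto (markovApprox g c) atTop (𝓝 g) := by
  let _ : UniformSpace A := ⊥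
  have : DiscreteUniformity A := ⟨rfl⟩
  have htop : (inferInstance : TopologicalSpace A) = UniformSpace.toTopologicalSpace :=
    DiscreteTopology.eq_bot (α := A)
  subst htop
  rw [ContinuousMap.tendsto_iff_tendstoUniformly]
  have hu : UniformContinuous g := CompactSpace.uniformContinuous_of_continuous g.continuous
  have hid : TendstoUniformly (fun n => truncate c (n + 1)) id atTop := by
    rw [tendstoUniformly_iff_tendsto, Pi.uniformity, tendsto_iInf]
    intro i
    rw [tendsto_comap_iff]
    have hev : ∀ᶠ q : ℕ × PastSpace A in atTop ×ˢ ⊤, q.2 i = truncate c (q.1 + 1) q.2 i := by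
      filter_upwards [(eventually_ge_atTop i).prod_inl (⊤ : Filter (PastSpace A))] with q hq
      simp [truncate, Nat.lt_succ_of_le hq]
    refine (tendsto_diag_uniformity (fun q : ℕ × PastSpace A => q.2 i) _).congr' ?_
    filter_upwards [hev] with q hq
    simp only [Function.comp_apply, id]
    rw [← hq]
  exact hu.comp_tendstoUniformly hid

end Truncate

/-- This and the next three comparisons, composed with the monotonicity of `x ↦ g (cons up x)`, give
the kernel comparisons required by `exists_monotone_coupling`. -/
lemma truncate_le_truncate {n m : ℕ} (h : n ≤ m) {x x' : PastSpace Spin} (hx : x' ≤ x) :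
    truncate up m x' ≤ truncate up n x := by
  intro i
  simp only [truncate]
  split_ifs with h1 h2
  · exact hx i
  · exact le_up _
  · lia
  · exact le_rfl

lemma le_truncate_up (n : ℕ) {x x' : PastSpace Spin} (hx : x' ≤ x) : x' ≤ truncate up n x := by
  intro i
  simp only [truncate]
  split_ifs
  · exact hx i
  · exact le_up _

lemma truncate_down_le_truncate {n m : ℕ} (h : n ≤ m) {x x' : PastSpace Spin} (hx : x' ≤ x) :
    truncate down n x' ≤ truncate down m x := by
  intro i
  simp only [truncate]
  split_ifs with h1 h2
  · exact hx i
  · lia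
  · exact down_le _
  · exact le_rfl

lemma truncate_down_le (n : ℕ) {x x' : PastSpace Spin} (hx : x' ≤ x) :
    truncate down n x' ≤ x := by
  intro i
  simp only [truncate]
  split_ifs
  · exact hx i
  · exact down_le _

/-- The probabilities of a letter under two measures differ by at most their `d̄`-distance. -/
lemma measure_coord_le_add_dbar {A : Type} [TopologicalSpace A] [DiscreteTopology A] [Finite A]
    [MeasurableSpace A] [BorelSpace A] (μ μ' : Measure (PastSpace A)) (a : A) :
    μ {x | x 0 = a} ≤ μ' {x | x 0 = a} + dbar μ μ' := by
  have hs := (isClopen_coord_eq a).isOpen.measurableSet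
  rw [dbar]
  simp only [ENNReal.add_iInf]
  refine le_iInf₂ fun ν hν => ?_
  rw [← hν.1, ← hν.2.1, Measure.fst_apply hs, Measure.snd_apply hs]
  refine (measure_mono fun z hz => ?_).trans (measure_union_le _ _)
  by_cases h : z.1 0 = z.2 0
  · exact Or.inl (h.symm.trans hz)
  · exact Or.inr h

lemma real_le_of_ae_le {Ω : Type*} [MeasurableSpace Ω] {μ : Measure Ω} [IsFiniteMeasure μ]
    {s t : Set Ω} (h : s ≤ᵐ[μ] t) : μ.real s ≤ μ.real t :=
  ENNReal.toReal_mono (by finiteness) (measure_mono_ae h)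

/-! ### `d̄` between components of a stationary coupling -/

section Coupling

variable {I : Type*} {ν : Measure (I → PastSpace Spin)}

lemma isClopen_component_eq (i : I) (a : Spin) :
    IsClopen {ω : I → PastSpace Spin | ω i 0 = a} :=
  (isClopen_coord_eq a).preimage (continuous_apply i)

lemma dbar_map_le (hν : MeasurePreserving (fun ω i => shift (ω i)) ν ν) (i j : I) :
    dbar (ν.map fun ω => ω i) (ν.map fun ω => ω j) ≤ ν {ω | ω i 0 ≠ ω j 0} := by
  have hm : Measurable fun ω : I → PastSpace Spin => (ω i, ω j) :=
    (measurable_pi_apply i).prodMk (measurable_pi_apply j)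
  have hS := (measurable_shift (A := Spin)).prodMap (measurable_shift (A := Spin))
  have hmem : ν.map (fun ω => (ω i, ω j)) ∈
      stationaryCouplings (ν.map fun ω => ω i) (ν.map fun ω => ω j) := by
    refine ⟨?_, ?_, hS, ?_⟩
    · rw [Measure.fst, Measure.map_map measurable_fst hm]; rfl
    · rw [Measure.snd, Measure.map_map measurable_snd hm]; rfl
    · rw [Measure.map_map hS hm]
      conv_rhs => rw [← hν.map_eq, Measure.map_map hm hν.measurable]
      rfl
  refine (iInf₂_le _ hmem).trans ?_
  rw [Measure.map_apply hm (measurableSet_coord_ne 0)]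
  rfl

/-- Components of a stationary coupling that agree at time `0` have the same law. -/
lemma map_eq_of_coord_eq (hν : MeasurePreserving (fun ω i => shift (ω i)) ν ν) {i j : I}
    (h : ν {ω | ω i 0 ≠ ω j 0} = 0) : (ν.map fun ω => ω i) = ν.map fun ω => ω j := by
  have hiter : ∀ n (ω : I → PastSpace Spin) i,
      (fun (ω : I → PastSpace Spin) i => shift (ω i))^[n] ω i 0 = ω i n := by
    intro n
    induction n with
    | zero => intro ω i; rfl
    | succ n ih => intro ω i; rw [Function.iterate_succ_apply, ih]; rfl
  have hn : ∀ n, ∀ᵐ ω ∂ν, ω i n = ω j n := by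
    intro n
    have h0 : ∀ᵐ ω ∂ν, ω i 0 = ω j 0 := h
    have := (hν.iterate n).quasiMeasurePreserving.ae h0
    simpa only [hiter] using this
  exact Measure.map_congr ((ae_all_iff.2 hn).mono fun ω hω => funext hω)

variable [IsProbabilityMeasure ν]

/-- Ordered components can differ at time `0` only as `+1` above `-1`, so the discrepancy has the
probability of a difference of nested events. -/
lemma dbar_map_le_of_le [Countable I]
    (hν : MeasurePreserving (fun ω i => shift (ω i)) ν ν) {i j : I}
    (hij : ∀ᵐ ω ∂ν, ω j ≤ ω i) : dbar (ν.map fun ω => ω i) (ν.map fun ω => ω j) ≤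
      ENNReal.ofReal (ν.real {ω | ω i 0 = up} - ν.real {ω | ω j 0 = up}) := by
  refine (dbar_map_le hν i j).trans ?_
  have hsub : {ω : I → PastSpace Spin | ω i 0 ≠ ω j 0} ≤ᵐ[ν]
      ({ω | ω i 0 = up} \ {ω | ω j 0 = up} : Set (I → PastSpace Spin)) := by
    filter_upwards [hij] with ω hω hne
    have h0 : ω j 0 ≤ ω i 0 := hω 0
    rcases eq_up_or_eq_down (ω j 0) with hj | hj
    · exact absurd ((eq_up_of_up_le (hj ▸ h0)).trans hj.symm) hne
    · refine ⟨?_, fun h => down_ne_up (hj.symm.trans h)⟩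
      exact (eq_up_or_eq_down _).resolve_right fun h => hne (h.trans hj.symm)
  have hle : ({ω | ω j 0 = up} : Set (I → PastSpace Spin)) ≤ᵐ[ν] {ω | ω i 0 = up} := by
    filter_upwards [hij] with ω hω h
    exact eq_up_of_up_le (le_of_eq_of_le h.symm (hω 0))
  refine (measure_mono_ae hsub).trans ?_
  have hdiff := measureReal_sdiff_add_inter (μ := ν) (s := {ω | ω i 0 = up})
    (isClopen_component_eq j up).isOpen.measurableSet
  have hinter : ν.real ({ω | ω i 0 = up} ∩ {ω | ω j 0 = up}) = ν.real {ω | ω j 0 = up} := by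
    refine measureReal_congr ?_
    filter_upwards [hle] with ω hω
    exact propext ⟨fun h => h.2, fun h => ⟨hω h, h⟩⟩
  rw [← ofReal_measureReal (μ := ν)]
  exact ENNReal.ofReal_le_ofReal (by linarith)

lemma ofReal_sub_le_dbar_map (i j : I) :
    ENNReal.ofReal (ν.real {ω | ω i 0 = up} - ν.real {ω | ω j 0 = up}) ≤
      dbar (ν.map fun ω => ω i) (ν.map fun ω => ω j) := by
  have hs := (isClopen_coord_eq up).isOpen.measurableSet
  have h := measure_coord_le_add_dbar (ν.map fun ω => ω i) (ν.map fun ω => ω j) up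
  rw [Measure.map_apply (measurable_pi_apply i) hs, Measure.map_apply (measurable_pi_apply j) hs]
    at h
  rw [ENNReal.ofReal_sub _ measureReal_nonneg, ofReal_measureReal, ofReal_measureReal]
  exact tsub_le_iff_left.2 h

end Coupling

/-! ### Construction of the two Markov sequences -/

/-- If an attractive `g` has two `g`-measures, then its Markov approximations with boundary
conditions `+1` and `-1` satisfy the `d̄`-criterion. -/
theorem exists_markov_of_ne {g : C(PastSpace Spin, ℝ)} (hg : g ∈ posGFunctions Spin)
    (hattr : Attractive g) {μ μ' : Measure (PastSpace Spin)} (hμ : IsGMeasure g μ)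
    (hμ' : IsGMeasure g μ') (hne : μ ≠ μ') :
    ∃ m m' : ℕ → Measure (PastSpace Spin),
      (∀ j, IsGMeasure (markovApprox g up (j + 1)) (m j)) ∧
      (∀ j, IsGMeasure (markovApprox g down (j + 1)) (m' j)) ∧
      (∑' j : ℕ, dbar (m j) (m (j + 1))) + (∑' j : ℕ, dbar (m' j) (m' (j + 1))) <
        dbar (m 0) (m' 0) := by
  have := hμ.isProbabilityMeasure
  have := hμ'.isProbabilityMeasure
  have hmono := hattr.monotone_up
  let h : ℕ ⊕ ℕ ⊕ Bool → C(PastSpace Spin, ℝ) :=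
    Sum.elim (fun j => markovApprox g up (j + 1))
      (Sum.elim (fun j => markovApprox g down (j + 1)) fun _ => g)
  have hh : ∀ i, IsGFunction (h i) := by
    rintro (j | j | b)
    · exact isGFunction_markovApprox hg.1 _ _
    · exact isGFunction_markovApprox hg.1 _ _
    · exact hg.1
  -- Extremal starting pasts put the plus chains above everything and the minus chains below. The
  -- two copies of `g` start independently from `μ` and `μ'`, which the coupling keeps as marginals.
  let start : PastSpace Spin × PastSpace Spin → ℕ ⊕ ℕ ⊕ Bool → PastSpace Spin := fun z =>
    Sum.elim (fun _ _ => up) (Sum.elim (fun _ _ => down) fun b => if b then z.1 else z.2)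
  have hstart : Measurable start := by
    refine measurable_pi_lambda _ ?_
    rintro (j | j | b)
    · exact measurable_const
    · exact measurable_const
    · cases b
      · exact measurable_snd
      · exact measurable_fst
  let ν₀ := (μ.prod μ').map start
  have : IsProbabilityMeasure ν₀ := Measure.isProbabilityMeasure_map hstart.aemeasurable
  obtain ⟨ν, hν, hinv, hG, hfix, hord⟩ := exists_monotone_coupling h hh ν₀
  have hstart_le : ∀ i j, (∀ z, start z j ≤ start z i) → ∀ᵐ ω ∂ν₀, ω j ≤ ω i := by
    intro i j hij
    exact (ae_map_iff hstart.aemeasurable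
      (isClosed_le (continuous_apply j) (continuous_apply i)).measurableSet).2 (ae_of_all _ hij)
  have htrue : (ν.map fun ω => ω (.inr (.inr true))) = μ := by
    have h0 : (ν₀.map fun ω => ω (.inr (.inr true))) = μ := by
      rw [Measure.map_map (measurable_pi_apply _) hstart]
      exact Measure.fst_prod
    rw [hfix _ (by rw [h0]; exact hμ), h0]
  have hfalse : (ν.map fun ω => ω (.inr (.inr false))) = μ' := by
    have h0 : (ν₀.map fun ω => ω (.inr (.inr false))) = μ' := by
      rw [Measure.map_map (measurable_pi_apply _) hstart]
      exact Measure.snd_prod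
    rw [hfix _ (by rw [h0]; exact hμ'), h0]
  have hup : ∀ j, ∀ᵐ ω ∂ν, ω (.inl (j + 1)) ≤ ω (.inl j) := fun j =>
    hord _ _ (fun x x' hx => by
      simp only [h, Sum.elim_inl, markovApprox_cons]
      exact hmono (truncate_le_truncate (Nat.le_succ _) hx))
      (hstart_le _ _ fun z => le_rfl)
  have hdown : ∀ j, ∀ᵐ ω ∂ν, ω (.inr (.inl j)) ≤ ω (.inr (.inl (j + 1))) := fun j =>
    hord _ _ (fun x x' hx => by
      simp only [h, Sum.elim_inl, Sum.elim_inr, markovApprox_cons]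
      exact hmono (truncate_down_le_truncate (Nat.le_succ _) hx))
      (hstart_le _ _ fun z => le_rfl)
  have hmid_up : ∀ j b, ∀ᵐ ω ∂ν, ω (.inr (.inr b)) ≤ ω (.inl j) := fun j b =>
    hord _ _ (fun x x' hx => by
      simp only [h, Sum.elim_inl, Sum.elim_inr, markovApprox_cons]
      exact hmono (le_truncate_up _ hx))
      (hstart_le _ _ fun z n => le_up _)
  have hmid_down : ∀ j b, ∀ᵐ ω ∂ν, ω (.inr (.inl j)) ≤ ω (.inr (.inr b)) := fun j b =>
    hord _ _ (fun x x' hx => by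
      simp only [h, Sum.elim_inl, Sum.elim_inr, markovApprox_cons]
      exact hmono (truncate_down_le _ hx))
      (hstart_le _ _ fun z n => down_le _)
  let a : ℕ → ℝ := fun j => ν.real {ω | ω (.inl j) 0 = up}
  let a' : ℕ → ℝ := fun j => ν.real {ω | ω (.inr (.inl j)) 0 = up}
  let D : Set (ℕ ⊕ ℕ ⊕ Bool → PastSpace Spin) :=
    {ω | ω (.inr (.inr true)) 0 ≠ ω (.inr (.inr false)) 0}
  have hD : 0 < ν.real D := by
    refine lt_of_le_of_ne measureReal_nonneg fun h0 => hne ?_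
    rw [← htrue, ← hfalse]
    exact map_eq_of_coord_eq hinv ((measureReal_eq_zero_iff).1 h0.symm)
  -- If the `n`-th minus chain shows `+1`, both copies of `g` do, which excludes `D`. On `D` one
  -- copy shows `+1`, hence so does the `n`-th plus chain. Two disjoint events thus lie in a third.
  have hgap : ∀ n, a' n + ν.real D ≤ a n := by
    intro n
    have hae : ∀ᵐ ω ∂ν, (∀ b, ω (.inr (.inr b)) ≤ ω (.inl n)) ∧
        ∀ b, ω (.inr (.inl n)) ≤ ω (.inr (.inr b)) :=
      (ae_all_iff.2 (hmid_up n)).and (ae_all_iff.2 (hmid_down n))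
    have hDm : MeasurableSet D :=
      ((isClopen_discrete {p : Spin × Spin | p.1 ≠ p.2}).preimage
        (f := fun ω : ℕ ⊕ ℕ ⊕ Bool → PastSpace Spin =>
          (ω (.inr (.inr true)) 0, ω (.inr (.inr false)) 0)) (by fun_prop)).isOpen.measurableSet
    have hdisj : AEDisjoint ν {ω | ω (.inr (.inl n)) 0 = up} D := by
      refine measure_mono_null (t := {ω | ¬ ((∀ b, ω (.inr (.inr b)) ≤ ω (.inl n)) ∧
        ∀ b, ω (.inr (.inl n)) ≤ ω (.inr (.inr b)))}) (fun ω hω hω' => ?_) hae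
      have hb : ∀ b, ω (.inr (.inr b)) 0 = up := fun b =>
        eq_up_of_up_le (le_of_eq_of_le hω.1.symm (hω'.2 b 0))
      exact hω.2 ((hb true).trans (hb false).symm)
    rw [← measureReal_union₀ hDm.nullMeasurableSet hdisj]
    refine real_le_of_ae_le ?_
    filter_upwards [hae] with ω hω hmem
    by_contra hcon
    have hd : ω (.inl n) 0 = down := eq_down_of_ne_up hcon
    have hb : ∀ b, ω (.inr (.inr b)) 0 = down := fun b =>
      le_antisymm ((hω.1 b 0).trans hd.le) (down_le _)
    rcases hmem with hmem | hmem
    · have := hω.2 true 0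
      rw [hb, show ω (.inr (.inl n)) 0 = up from hmem] at this
      exact down_ne_up (eq_up_of_up_le this)
    · exact hmem ((hb true).trans (hb false).symm)
  refine ⟨fun j => ν.map fun ω : ℕ ⊕ ℕ ⊕ Bool → PastSpace Spin => ω (.inl j),
    fun j => ν.map fun ω : ℕ ⊕ ℕ ⊕ Bool → PastSpace Spin => ω (.inr (.inl j)),
    fun j => hG (.inl j), fun j => hG (.inr (.inl j)), ?_⟩
  have hanti : ∀ j, a (j + 1) ≤ a j := fun j => real_le_of_ae_le (by
    filter_upwards [hup j] with ω hω hmem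
    exact eq_up_of_up_le (le_of_eq_of_le (show ω (.inl (j + 1)) 0 = up from hmem).symm (hω 0)))
  have hmono' : ∀ j, a' j ≤ a' (j + 1) := fun j => real_le_of_ae_le (by
    filter_upwards [hdown j] with ω hω hmem
    exact eq_up_of_up_le (le_of_eq_of_le (show ω (.inr (.inl j)) 0 = up from hmem).symm (hω 0)))
  have hsum : (∑' j : ℕ, dbar (ν.map fun ω => ω (.inl j)) (ν.map fun ω => ω (.inl (j + 1)))) +
      (∑' j : ℕ, dbar (ν.map fun ω => ω (.inr (.inl j)))
        (ν.map fun ω => ω (.inr (.inl (j + 1))))) ≤ ENNReal.ofReal (a 0 - a' 0 - ν.real D) := by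
    rw [← ENNReal.tsum_add]
    refine ENNReal.tsum_le_of_sum_range_le fun n => ?_
    calc _ ≤ ∑ j ∈ Finset.range n, ENNReal.ofReal ((a j - a (j + 1)) + (a' (j + 1) - a' j)) := by
          refine Finset.sum_le_sum fun j _ => ?_
          rw [ENNReal.ofReal_add (sub_nonneg.2 (hanti j)) (sub_nonneg.2 (hmono' j))]
          exact add_le_add (dbar_map_le_of_le hinv (hup j))
            ((dbar_comm_le _ _).trans (dbar_map_le_of_le hinv (hdown j)))
      _ = ENNReal.ofReal ((a 0 - a n) + (a' n - a' 0)) := by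
          rw [← ENNReal.ofReal_sum_of_nonneg fun j _ => add_nonneg (sub_nonneg.2 (hanti j))
            (sub_nonneg.2 (hmono' j)), Finset.sum_add_distrib, Finset.sum_range_sub',
            Finset.sum_range_sub]
      _ ≤ _ := ENNReal.ofReal_le_ofReal (by linarith [hgap n])
  -- Strictness comes from `ν.real D > 0`. It survives `ENNReal.ofReal` because the gap makes `a 0 -
  -- a' 0` positive.
  refine hsum.trans_lt (lt_of_lt_of_le ?_ (ofReal_sub_le_dbar_map _ _))
  have := hgap 0
  exact (ENNReal.ofReal_lt_ofReal_iff (by simp only [a, a'] at this hD ⊢; linarith)).2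
    (by simp only [a, a']; linarith)

end GMeas

end

theorem theorem2 (g : C(GMeas.PastSpace GMeas.Spin, ℝ))
    (hg : g ∈ GMeas.posGFunctions GMeas.Spin) (hattr : GMeas.Attractive g) :
    (∃ μ μ' : Measure (GMeas.PastSpace GMeas.Spin),
        GMeas.IsGMeasure g μ ∧ GMeas.IsGMeasure g μ' ∧ μ ≠ μ') ↔
      ∃ (G G' : ℕ → C(GMeas.PastSpace GMeas.Spin, ℝ))
        (μ μ' : ℕ → Measure (GMeas.PastSpace GMeas.Spin)),
        (∀ j, G j ∈ GMeas.allMarkovKernels GMeas.Spin) ∧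
        (∀ j, G' j ∈ GMeas.allMarkovKernels GMeas.Spin) ∧
        Tendsto G atTop (𝓝 g) ∧ Tendsto G' atTop (𝓝 g) ∧
        (∀ j, GMeas.IsGMeasure (G j) (μ j)) ∧ (∀ j, GMeas.IsGMeasure (G' j) (μ' j)) ∧
        ∃ k : ℕ,
          (∑' j : ℕ, GMeas.dbar (μ (k + j)) (μ (k + j + 1))) +
              (∑' j : ℕ, GMeas.dbar (μ' (k + j)) (μ' (k + j + 1))) <
            GMeas.dbar (μ k) (μ' k) := by
  constructor
  · rintro ⟨μ, μ', hμ, hμ', hne⟩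
    obtain ⟨m, m', hm, hm', hlt⟩ := GMeas.exists_markov_of_ne hg hattr hμ hμ' hne
    -- Orders start at `1` because the primitivity argument needs a nonempty word.
    have hmem : ∀ c j, GMeas.markovApprox g c (j + 1) ∈ GMeas.allMarkovKernels GMeas.Spin :=
      fun c j => Set.mem_iUnion.2
        ⟨j + 1, GMeas.markovApprox_mem_markovKernels hg c j.succ_pos⟩
    have hlim : ∀ c, Tendsto (fun j => GMeas.markovApprox g c (j + 1)) atTop (𝓝 g) :=
      fun c => (GMeas.tendsto_markovApprox g c).comp (tendsto_add_atTop_nat 1)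
    exact ⟨_, _, m, m', hmem GMeas.up, hmem GMeas.down, hlim _, hlim _, hm, hm', 0, by
      simpa only [Nat.zero_add] using hlt⟩
  · rintro ⟨G, G', μ, μ', -, -, hG, hG', hμ, hμ', k, hlt⟩
    exact GMeas.exists_ne_of_tsum_dbar_lt hg.1 hG hG' hμ hμ' hlt
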